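/- For $n\in\mathbb{N}=\{1,2,\ldots\}$, an integer $k$ is called regular (mod $n$) if there exists $x\in\mathbb{Z}$ such that $k^2x\equiv k \pmod n$. Let $\varrho(n)$ be the number of integers $k\in\{1,2,\ldots,n\}$ that are regular (mod $n$), let $\sigma(n)$ be the sum of the positive divisors of $n$, and let $\psi(n)=n\prod_{p\mid n}\left(1+\frac1p\right)$ (product over the primes $p$ dividing $n$) be the Dedekind function. Then $$\limsup_{n\to\infty}\frac{\varrho(n)\sigma(n)}{n^2\log\log n}=\limsup_{n\to\infty}\frac{\varrho(n)\psi(n)}{n^2\log\log n}=\frac{6}{\pi^2}e^{\gamma},$$ where $\gamma$ is the Euler–Mascheroni constant. -/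

import Mathlib

/-- The integer `k` is regular modulo `n`: there is an integer `x` with `k² x ≡ k (mod n)`. -/
def IsRegularMod (n : ℕ) (k : ℤ) : Prop :=
  ∃ x : ℤ, k ^ 2 * x ≡ k [ZMOD (n : ℤ)]

open Classical in
/-- `Reg_n`, the set of the integers `1 ≤ k ≤ n` that are regular modulo `n`. -/
noncomputable def regSet (n : ℕ) : Finset ℕ :=
  (Finset.Icc 1 n).filter (fun k => IsRegularMod n (k : ℤ))

/-- `ϱ(n)`, the number of regular integers modulo `n` in `{1, …, n}`. -/
noncomputable def regCount (n : ℕ) : ℕ :=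
  (regSet n).card

/-- The Dedekind function `ψ(n) = n ∏_{p ∣ n} (1 + 1/p)`, the product over the primes `p ∣ n`. -/
noncomputable def dedekindPsi (n : ℕ) : ℝ :=
  (n : ℝ) * ∏ p ∈ n.primeFactors, (1 + 1 / (p : ℝ))

/-! Both quotients are governed by `∏_{p ∣ n} (1 + 1/p) / log log n`. By multiplicativity and a
prime-power estimate, `ϱ(n) σ(n) ≤ n² ∏_{p ∣ n} (1 + 1/p)` (`regCount_mul_sigma_le`). Conversely `ψ
≤ σ`, and `ϱ(n) ψ(n)` attains this bound at squarefree `n`, where `ϱ(n) = n`. So an upper bound is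
needed only for `σ`, and a lower bound only for `ψ` along primorials. The product over `p ∣ n` is
essentially at most that over `p ≤ log n`, since larger prime factors are too few to matter. Its
size is `tendsto_prod_one_add_inv_div_log`, which combines Mertens' third theorem with `ζ(2) =
π²/6`. The constant `e^γ` comes from computing `∑_p p^{-1-δ} + log δ` as `δ → 0+` in two ways: by
Abel's limit theorem on dyadic blocks of primes, where the harmonic sum brings in `γ`, and from the
pole of `ζ` at `1` through the Euler product. -/

/-! ### Regular residues and the comparison of `ϱ`, `σ` and `ψ`. -/

/-- The set of the von Neumann regular elements of `ZMod n`. -/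
def regularResidues (n : ℕ) : Set (ZMod n) := {a | ∃ x, a ^ 2 * x = a}

lemma regCount_le_ncard_regularResidues {n : ℕ} (hn : n ≠ 0) :
    regCount n ≤ (regularResidues n).ncard := by
  have : NeZero n := ⟨hn⟩
  rw [regCount, ← Set.ncard_coe_finset]
  refine Set.ncard_le_ncard_of_injOn (fun k : ℕ => (k : ZMod n)) ?_ ?_ (Set.toFinite _)
  · intro k hk
    simp only [regSet, Finset.coe_filter, Set.mem_ofPred_eq] at hk
    obtain ⟨x, hx⟩ := hk.2
    refine ⟨(x : ZMod n), ?_⟩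
    have := (ZMod.intCast_eq_intCast_iff _ _ n).2 hx
    push_cast at this
    exact this
  · intro k hk l hl hkl
    simp only [regSet, Finset.coe_filter, Set.mem_ofPred_eq, Finset.mem_Icc] at hk hl
    have h := (ZMod.natCast_eq_natCast_iff _ _ n).1 hkl
    rcases le_total k l with h1 | h1
    · have h2 := (Nat.modEq_iff_dvd' h1).1 h
      have := Nat.eq_zero_of_dvd_of_lt h2 (by omega)
      omega
    · have h2 := (Nat.modEq_iff_dvd' h1).1 h.symm
      have := Nat.eq_zero_of_dvd_of_lt h2 (by omega)
      omega

lemma ncard_regularResidues_mul {m n : ℕ} (h : m.Coprime n) :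
    (regularResidues (m * n)).ncard = (regularResidues m).ncard * (regularResidues n).ncard := by
  rw [← Set.ncard_prod]
  refine Set.ncard_congr (fun a _ => ZMod.chineseRemainder h a) ?_ ?_ ?_
  · rintro a ⟨x, hx⟩
    refine ⟨⟨(ZMod.chineseRemainder h x).1, ?_⟩, ⟨(ZMod.chineseRemainder h x).2, ?_⟩⟩
    · simpa using congrArg (fun z => (ZMod.chineseRemainder h z).1) hx
    · simpa using congrArg (fun z => (ZMod.chineseRemainder h z).2) hx
  · intro a b _ _ hab
    exact (ZMod.chineseRemainder h).injective hab
  · rintro ⟨a, b⟩ ⟨⟨x, hx⟩, ⟨y, hy⟩⟩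
    refine ⟨(ZMod.chineseRemainder h).symm (a, b),
      ⟨(ZMod.chineseRemainder h).symm (x, y), ?_⟩, by simp⟩
    rw [← map_pow, ← map_mul]
    simp only [Prod.pow_mk, Prod.mk_mul_mk]
    simp only at hx hy
    rw [hx, hy]

/-- A non-unit `z` modulo `p ^ a` is nilpotent, so `1 - z x` is a unit, and `z (1 - z x) = 0` forces
`z = 0`. Hence a regular residue is a unit or zero. -/
lemma ncard_regularResidues_prime_pow_le {p a : ℕ} (hp : p.Prime) (ha : 0 < a) :
    (regularResidues (p ^ a)).ncard ≤ p ^ (a - 1) * (p - 1) + 1 := by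
  have : NeZero (p ^ a) := ⟨pow_ne_zero _ hp.ne_zero⟩
  have hsub : regularResidues (p ^ a) ⊆
      insert 0 (Set.range (fun u : (ZMod (p ^ a))ˣ => (u : ZMod (p ^ a)))) := by
    rintro z ⟨x, hx⟩
    by_cases hz : IsUnit z
    · exact Or.inr ⟨hz.unit, rfl⟩
    left
    have hnil : IsNilpotent z := by
      refine ⟨a, ?_⟩
      have hv : p ∣ z.val := by
        by_contra hnd
        apply hz
        rw [← ZMod.natCast_zmod_val z, ZMod.isUnit_iff_coprime]
        exact Nat.Coprime.pow_right _ ((hp.coprime_iff_not_dvd.2 hnd).symm)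
      rw [← ZMod.natCast_zmod_val z, ← Nat.cast_pow, ZMod.natCast_eq_zero_iff]
      exact pow_dvd_pow_of_dvd hv a
    have hu : IsUnit (1 - z * x) := ((Commute.all z x).isNilpotent_mul_right hnil).isUnit_one_sub
    exact (hu.mul_left_eq_zero).1 (by linear_combination -hx)
  calc (regularResidues (p ^ a)).ncard
      ≤ _ := Set.ncard_le_ncard hsub (Set.toFinite _)
    _ ≤ (Set.range (fun u : (ZMod (p ^ a))ˣ => (u : ZMod (p ^ a)))).ncard + 1 :=
      Set.ncard_insert_le _ _
    _ = p ^ (a - 1) * (p - 1) + 1 := by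
      rw [← Set.image_univ, Set.ncard_image_of_injective _ Units.val_injective, Set.ncard_univ,
        Nat.card_eq_fintype_card, ZMod.card_units_eq_totient, Nat.totient_prime_pow hp ha]

/-- With `s = σ(p^a)` and `s (p - 1) = p^{a+1} - 1`, the claim becomes `s ≤ p^{2a-1} + p^{a-1}`.
This is an equality for `a = 1`; for `a ≥ 2` already `s ≤ p^{a+1} ≤ p^{2a-1}`. -/
lemma totient_add_one_mul_sigma_prime_pow_le {p a : ℕ} (hp : p.Prime) (ha : 0 < a) :
    (p ^ (a - 1) * (p - 1) + 1) * ArithmeticFunction.sigma 1 (p ^ a)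
      ≤ p ^ (2 * a - 1) * (p + 1) := by
  obtain ⟨b, rfl⟩ : ∃ b, a = b + 1 := ⟨a - 1, by omega⟩
  obtain ⟨q, rfl⟩ : ∃ q, p = q + 1 := ⟨p - 1, by have := hp.pos; omega⟩
  have hq : 1 ≤ q := by have := hp.two_le; omega
  have hs : ArithmeticFunction.sigma 1 ((q + 1) ^ (b + 1)) * q + 1 = (q + 1) ^ (b + 2) := by
    rw [ArithmeticFunction.sigma_one_apply_prime_pow hp]
    exact geom_sum_mul_add q (b + 2)
  set s := ArithmeticFunction.sigma 1 ((q + 1) ^ (b + 1)) with hs'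
  simp only [Nat.add_sub_cancel]
  rcases Nat.eq_zero_or_pos b with rfl | hb
  · simp only [zero_add] at hs
    have : s = q + 2 := by
      have : s * q = (q + 2) * q := by linarith [hs, show (q + 1) ^ 2 = (q + 2) * q + 1 by ring]
      exact Nat.eq_of_mul_eq_mul_right hq this
    rw [this]; norm_num
  · have h2 : s ≤ (q + 1) ^ (b + 2) := by nlinarith
    have h3 : (q + 1) ^ (b + 2) ≤ (q + 1) ^ (2 * b + 1) := Nat.pow_le_pow_right (by omega) (by omega)
    have e1 : 2 * (b + 1) - 1 = 2 * b + 1 := by omega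
    rw [e1]
    have e2 : (q + 1) ^ b * (s * q + 1) = (q + 1) ^ b * (q + 1) ^ (b + 2) := by rw [hs]
    have e3 : (q + 1) ^ b * (q + 1) ^ (b + 2) = (q + 1) ^ (2 * b + 1) * (q + 1) := by
      rw [← pow_add, ← pow_succ]; congr 1; omega
    nlinarith [Nat.zero_le ((q + 1) ^ b)]

lemma ncard_regularResidues_mul_sigma_le (n : ℕ) (hn : n ≠ 0) :
    ((regularResidues n).ncard : ℝ) * ArithmeticFunction.sigma 1 n
      ≤ (n : ℝ) ^ 2 * ∏ p ∈ n.primeFactors, (1 + 1 / (p : ℝ)) := by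
  induction n using Nat.recOnPosPrimePosCoprime with
  | zero => exact absurd rfl hn
  | one =>
    have : (regularResidues 1).ncard ≤ 1 := Set.ncard_le_one_of_subsingleton _
    simpa using this
  | prime_pow p a hp ha =>
    have hp0 : (p : ℝ) ≠ 0 := by exact_mod_cast hp.ne_zero
    have h := (Nat.mul_le_mul_right _ (ncard_regularResidues_prime_pow_le hp ha)).trans
      (totient_add_one_mul_sigma_prime_pow_le hp ha)
    have h' : ((regularResidues (p ^ a)).ncard : ℝ) * ArithmeticFunction.sigma 1 (p ^ a)
      ≤ (p : ℝ) ^ (2 * a - 1) * (p + 1) := by exact_mod_cast h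
    refine h'.trans_eq ?_
    rw [Nat.primeFactors_prime_pow ha.ne' hp, Finset.prod_singleton]
    push_cast
    rw [← pow_mul, show a * 2 = (2 * a - 1) + 1 by omega, pow_succ]
    field_simp
  | coprime m n hm hn' hmn ihm ihn =>
    rw [ncard_regularResidues_mul hmn,
      ArithmeticFunction.isMultiplicative_sigma.map_mul_of_coprime hmn,
      hmn.primeFactors_mul, Finset.prod_union hmn.disjoint_primeFactors]
    have h1 := ihm (by omega)
    have h2 := ihn (by omega)
    push_cast
    calc _ = (((regularResidues m).ncard : ℝ) * ArithmeticFunction.sigma 1 m) *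
          (((regularResidues n).ncard : ℝ) * ArithmeticFunction.sigma 1 n) := by ring
      _ ≤ _ := mul_le_mul h1 h2 (by positivity) (by positivity)
      _ = _ := by ring

lemma regCount_mul_sigma_le (n : ℕ) (hn : n ≠ 0) :
    (regCount n : ℝ) * ArithmeticFunction.sigma 1 n
      ≤ (n : ℝ) ^ 2 * ∏ p ∈ n.primeFactors, (1 + 1 / (p : ℝ)) := by
  refine le_trans ?_ (ncard_regularResidues_mul_sigma_le n hn)
  gcongr
  exact regCount_le_ncard_regularResidues hn

lemma dedekindPsi_le_sigma (n : ℕ) : dedekindPsi n ≤ ArithmeticFunction.sigma 1 n := by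
  induction n using Nat.recOnPosPrimePosCoprime with
  | zero => simp [dedekindPsi]
  | one => simp [dedekindPsi]
  | prime_pow p a hp ha =>
    have hp0 : (p : ℝ) ≠ 0 := by exact_mod_cast hp.ne_zero
    rw [dedekindPsi, Nat.primeFactors_prime_pow ha.ne' hp, Finset.prod_singleton,
      ArithmeticFunction.sigma_one_apply_prime_pow hp]
    obtain ⟨b, rfl⟩ : ∃ b, a = b + 1 := ⟨a - 1, by omega⟩
    rw [Finset.sum_range_succ, Finset.sum_range_succ]
    push_cast
    have : (0 : ℝ) ≤ ∑ i ∈ Finset.range b, (p : ℝ) ^ i := by positivity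
    have e : (p : ℝ) ^ (b + 1) * (1 + 1 / p) = p ^ (b + 1) + p ^ b := by
      rw [pow_succ]; field_simp
    linarith
  | coprime m n hm hn hmn ihm ihn =>
    rw [ArithmeticFunction.isMultiplicative_sigma.map_mul_of_coprime hmn]
    have e : dedekindPsi (m * n) = dedekindPsi m * dedekindPsi n := by
      simp only [dedekindPsi]
      rw [hmn.primeFactors_mul, Finset.prod_union hmn.disjoint_primeFactors]
      push_cast; ring
    rw [e]; push_cast
    exact mul_le_mul ihm ihn (by unfold dedekindPsi; positivity) (by positivity)

/-- Squarefreeness makes `gcd(k², n)` divide `k`, so the Bézout identity for `k²` and `n`, scaled by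
the cofactor, supplies the witness `x`. -/
lemma regCount_of_squarefree {n : ℕ} (hn : Squarefree n) : regCount n = n := by
  have : regSet n = Finset.Icc 1 n := by
    classical
    rw [regSet]
    refine Finset.filter_true_of_mem fun k _ => ?_
    have hg : (k ^ 2).gcd n ∣ k :=
      ((hn.squarefree_of_dvd (Nat.gcd_dvd_right _ n)).dvd_pow_iff_dvd two_ne_zero).1
        (Nat.gcd_dvd_left _ n)
    obtain ⟨c, hc⟩ := hg
    refine ⟨(k ^ 2).gcdA n * c, ?_⟩
    have hb := Nat.gcd_eq_gcd_ab (k ^ 2) n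
    have hc' : (k : ℤ) = ((k ^ 2).gcd n : ℤ) * c := by exact_mod_cast hc
    rw [hb] at hc'
    refine (Int.modEq_iff_dvd).2 ⟨(k ^ 2).gcdB n * c, ?_⟩
    push_cast at hc' ⊢
    linear_combination hc'
  rw [regCount, this]; simp

/-! ### Mertens' first and second theorems. -/

open Filter Topology

/-- The function that sends a prime `p` to `1 / p` and every other natural number to `0`. -/
noncomputable def primeInv (n : ℕ) : ℝ := if n.Prime then 1 / (n : ℝ) else 0

lemma primeInv_nonneg (n : ℕ) : 0 ≤ primeInv n := by
  unfold primeInv; split_ifs <;> positivity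

lemma primeInv_le (n : ℕ) : primeInv n ≤ 1 / (n : ℝ) := by
  unfold primeInv; split_ifs
  · rfl
  · positivity

lemma primeInv_zero : primeInv 0 = 0 := by simp [primeInv]

lemma primeInv_one : primeInv 1 = 0 := by simp [primeInv, Nat.not_prime_one]

lemma sum_Ioc_zero_eq_sum_range (f : ℕ → ℝ) (N : ℕ) :
    ∑ n ∈ Finset.Ioc 0 N, f n = ∑ n ∈ Finset.range N, f (n + 1) := by
  induction N with
  | zero => simp
  | succ N ih => rw [Finset.sum_Ioc_succ_top (Nat.zero_le N), ih, Finset.sum_range_succ]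

open ArithmeticFunction in
lemma log_factorial_eq_sum_vonMangoldt (N : ℕ) :
    Real.log (N.factorial) = ∑ n ∈ Finset.Ioc 0 N, vonMangoldt n * ((N / n : ℕ) : ℝ) := by
  rw [← sum_Ioc_mul_zeta_eq_sum, vonMangoldt_mul_zeta]
  induction N with
  | zero => simp
  | succ N ih =>
    rw [Finset.sum_Ioc_succ_top (Nat.zero_le N), ← ih, Nat.factorial_succ, Nat.cast_mul,
      Real.log_mul (by positivity) (by positivity), log_apply, add_comm]

open ArithmeticFunction in
-- Dropping the floors in `log N! = ∑ Λ(n) ⌊N/n⌋` costs at most `ψ(N)`, here Chebyshev's function,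
-- which is at most `(log 4 + 4) N`; and `log N!` lies between `N log N - N` and `N log N`.
lemma abs_sum_vonMangoldt_div_sub_log_le {N : ℕ} (hN : 1 ≤ N) :
    |∑ n ∈ Finset.Ioc 0 N, vonMangoldt n / n - Real.log N| ≤ Real.log 4 + 4 := by
  have hN0 : (0 : ℝ) < N := by exact_mod_cast hN
  set T := ∑ n ∈ Finset.Ioc 0 N, vonMangoldt n / (n : ℝ) with hT
  have h4 : 0 < Real.log 4 := Real.log_pos (by norm_num)
  have hpsi : ∑ n ∈ Finset.Ioc 0 N, vonMangoldt n ≤ (Real.log 4 + 4) * N := by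
    simpa [Chebyshev.psi] using Chebyshev.psi_le_const_mul_self (x := (N : ℝ)) hN0.le
  have hup : Real.log N.factorial ≤ T * N := by
    rw [log_factorial_eq_sum_vonMangoldt, hT, Finset.sum_mul]
    refine Finset.sum_le_sum fun n _ => ?_
    rw [div_mul_eq_mul_div, mul_div_assoc]
    exact mul_le_mul_of_nonneg_left Nat.cast_div_le vonMangoldt_nonneg
  have hlo : T * N - (Real.log 4 + 4) * N ≤ Real.log N.factorial := by
    refine le_trans (sub_le_sub_left hpsi _) ?_
    rw [log_factorial_eq_sum_vonMangoldt, hT, Finset.sum_mul, ← Finset.sum_sub_distrib]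
    refine Finset.sum_le_sum fun n hn => ?_
    have hn0 : 0 < n := (Finset.mem_Ioc.1 hn).1
    have h1 : (N : ℝ) / n - 1 ≤ ((N / n : ℕ) : ℝ) := by
      have := Nat.lt_div_mul_add (a := N) hn0
      rw [sub_le_iff_le_add, div_le_iff₀ (by exact_mod_cast hn0)]
      have h2 : (N : ℝ) < (N / n : ℕ) * n + n := by exact_mod_cast this
      linarith
    calc vonMangoldt n / n * N - vonMangoldt n = vonMangoldt n * ((N : ℝ) / n - 1) := by ring
      _ ≤ _ := mul_le_mul_of_nonneg_left h1 vonMangoldt_nonneg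
  have hf1 : Real.log N.factorial ≤ N * Real.log N := by
    rw [← Real.log_pow]
    exact Real.log_le_log (by positivity) (by exact_mod_cast Nat.factorial_le_pow N)
  have hf2 : N * Real.log N - N ≤ Real.log N.factorial := by
    have := Stirling.le_log_factorial_stirling (n := N) (by omega)
    have h1 : 0 ≤ Real.log N := Real.log_natCast_nonneg N
    have h2 : 0 ≤ Real.log (2 * Real.pi) := Real.log_nonneg (by linarith [Real.pi_gt_three])
    linarith
  rw [abs_le]
  constructor
  · have : Real.log N - 1 ≤ T := le_of_mul_le_mul_right (by linarith) hN0
    linarith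
  · have : T - (Real.log 4 + 4) ≤ Real.log N := le_of_mul_le_mul_right (by linarith) hN0
    linarith

open ArithmeticFunction in
/-- Mertens' first theorem. -/
theorem exists_abs_sum_primeInv_mul_log_sub_log_le :
    ∃ C : ℝ, ∀ N : ℕ, 1 ≤ N →
      |∑ n ∈ Finset.range (N + 1), primeInv n * Real.log n - Real.log N| ≤ C := by
  -- Modulus `1` has a single residue class, so this is the convergence of the contribution of all
  -- proper prime powers.
  have hs := vonMangoldt.summable_residueClass_non_primes_div (q := 1) 0
  have e : ∀ n, vonMangoldt.residueClass (0 : ZMod 1) n = vonMangoldt n := fun n => by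
    rw [vonMangoldt.residueClass, Set.indicator_of_mem]
    exact Subsingleton.elim _ _
  simp only [e] at hs
  set g : ℕ → ℝ := fun n => (if n.Prime then 0 else vonMangoldt n) / (n : ℝ) with hg
  have hg0 : ∀ n, 0 ≤ g n := fun n => by
    have := vonMangoldt_nonneg (n := n)
    simp only [hg]; split_ifs <;> positivity
  refine ⟨Real.log 4 + 4 + ∑' n, g n, fun N hN => ?_⟩
  have h1 := abs_sum_vonMangoldt_div_sub_log_le hN
  have h2 : ∑ n ∈ Finset.range (N + 1), primeInv n * Real.log n
      = ∑ n ∈ Finset.Ioc 0 N, vonMangoldt n / n - ∑ n ∈ Finset.Ioc 0 N, g n := by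
    rw [Finset.sum_range_succ', ← Finset.sum_sub_distrib, primeInv_zero, zero_mul, add_zero,
      sum_Ioc_zero_eq_sum_range]
    refine Finset.sum_congr rfl fun n _ => ?_
    simp only [hg, primeInv]
    split_ifs with hp
    · rw [vonMangoldt_apply_prime hp]; ring
    · ring
  have h3 : ∑ n ∈ Finset.Ioc 0 N, g n ≤ ∑' n, g n := hs.sum_le_tsum _ fun i _ => hg0 i
  have h4 : 0 ≤ ∑ n ∈ Finset.Ioc 0 N, g n := Finset.sum_nonneg fun i _ => hg0 i
  rw [h2]
  rw [abs_le] at h1 ⊢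
  constructor <;> linarith [h1.1, h1.2]

/-- The main term of the partial summation below: a Riemann sum for `∫ d(log t) / log t = log log`.
From index `1` on, the difference `W` decreases while `W n - 1 / log (n + 1)` increases, so `W` is
monotone and bounded. -/
lemma exists_tendsto_sum_log_sub_log_div_log :
    ∃ L : ℝ, Tendsto (fun n : ℕ => ∑ i ∈ Finset.range n,
      (Real.log (i + 2) - Real.log (i + 1)) / Real.log (i + 2) - Real.log (Real.log (n + 1)))
      atTop (𝓝 L) := by
  set W : ℕ → ℝ := fun n : ℕ => ∑ i ∈ Finset.range n,
      (Real.log (i + 2) - Real.log (i + 1)) / Real.log (i + 2) - Real.log (Real.log (n + 1)) with hW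
  have key : ∀ n : ℕ, 1 ≤ n → W (n + 1) ≤ W n ∧
      W n - 1 / Real.log (n + 1) ≤ W (n + 1) - 1 / Real.log (n + 2) := by
    intro n hn
    have hn1 : (1 : ℝ) ≤ n := by exact_mod_cast hn
    have hL1 : 0 < Real.log (n + 1) := Real.log_pos (by linarith)
    have hL12 : Real.log (n + 1) ≤ Real.log (n + 2) := Real.log_le_log (by linarith) (by linarith)
    have hd : Real.log (n + 2) - Real.log (n + 1) ≤ 1 := by
      rw [← Real.log_div (by positivity) (by positivity)]
      refine (Real.log_le_sub_one_of_pos (by positivity)).trans ?_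
      rw [sub_le_iff_le_add, div_le_iff₀ (by positivity)]
      linarith
    have hWs : W (n + 1) = W n + (Real.log (n + 2) - Real.log (n + 1)) / Real.log (n + 2)
        - (Real.log (Real.log (n + 2)) - Real.log (Real.log (n + 1))) := by
      simp only [hW, Finset.sum_range_succ]
      push_cast
      rw [show (n : ℝ) + 1 + 1 = n + 2 by ring]
      ring
    rw [hWs]
    set a := Real.log (n + 1)
    set b := Real.log (n + 2)
    have hb : 0 < b := hL1.trans_le hL12
    rw [← Real.log_div hb.ne' hL1.ne']
    constructor
    · have := Real.one_sub_inv_le_log_of_pos (div_pos hb hL1)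
      rw [inv_div] at this
      have e : (b - a) / b = 1 - a / b := by field_simp
      linarith
    · have := Real.log_le_sub_one_of_pos (div_pos hb hL1)
      have e : (b - a) / b - (b / a - 1) + (1 / a - 1 / b) = (b - a) * (1 - (b - a)) / (a * b) := by
        field_simp; ring
      have : 0 ≤ (b - a) * (1 - (b - a)) / (a * b) :=
        div_nonneg (mul_nonneg (by linarith) (by linarith)) (by positivity)
      linarith
  have hanti : Antitone fun n => W (n + 1) := antitone_nat_of_succ_le fun n => (key (n + 1) (by omega)).1
  have hmono : Monotone fun n : ℕ => W (n + 1) - 1 / Real.log ((n + 1 : ℕ) + 1) := by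
    refine monotone_nat_of_le_succ fun n => ?_
    have := (key (n + 1) (by omega)).2
    rwa [show ((n + 1 : ℕ) : ℝ) + 2 = ((n + 1 + 1 : ℕ) : ℝ) + 1 by push_cast; ring] at this
  have hbdd : BddBelow (Set.range fun n => W (n + 1)) := by
    refine ⟨W (0 + 1) - 1 / Real.log ((0 + 1 : ℕ) + 1), ?_⟩
    rintro _ ⟨n, rfl⟩
    refine (hmono (Nat.zero_le n)).trans ?_
    have : 0 ≤ 1 / Real.log (((n + 1 : ℕ) : ℝ) + 1) :=
      one_div_nonneg.2 (Real.log_nonneg (by push_cast; linarith [n.cast_nonneg (α := ℝ)]))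
    simp only
    linarith
  exact ⟨_, (tendsto_add_atTop_iff_nat 1).1 (tendsto_atTop_ciInf hanti hbdd)⟩

/-- Mertens' second theorem. -/
theorem exists_tendsto_sum_primeInv_sub_log_log :
    ∃ M : ℝ, Tendsto (fun N : ℕ => ∑ n ∈ Finset.range (N + 1), primeInv n - Real.log (Real.log N))
      atTop (𝓝 M) := by
  obtain ⟨C, hC⟩ := exists_abs_sum_primeInv_mul_log_sub_log_le
  obtain ⟨L, hL⟩ := exists_tendsto_sum_log_sub_log_div_log
  -- Dirichlet's test: `z` has bounded partial sums by Mertens' first theorem, and the weights `1 /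
  -- log (i + 2)` decrease to zero.
  set z : ℕ → ℝ := fun i =>
    primeInv (i + 2) * Real.log (i + 2) - (Real.log (i + 2) - Real.log (i + 1)) with hz
  have hlogpos : ∀ i : ℕ, 0 < Real.log ((i : ℝ) + 2) := fun i =>
    Real.log_pos (by linarith [i.cast_nonneg (α := ℝ)])
  have hanti : Antitone fun i : ℕ => 1 / Real.log ((i : ℝ) + 2) := by
    intro i j hij
    refine one_div_le_one_div_of_le (hlogpos i) (Real.log_le_log (by positivity) ?_)
    have : (i : ℝ) ≤ j := by exact_mod_cast hij
    linarith
  have hzero : Tendsto (fun i : ℕ => 1 / Real.log ((i : ℝ) + 2)) atTop (𝓝 0) := by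
    simp only [one_div]
    exact (Real.tendsto_log_atTop.comp
      (tendsto_atTop_add_const_right _ 2 tendsto_natCast_atTop_atTop)).inv_tendsto_atTop
  have hsum : ∀ n, ∑ i ∈ Finset.range n, z i
      = ∑ j ∈ Finset.range (n + 1 + 1), primeInv j * Real.log j - Real.log (n + 1 : ℕ) := by
    intro n
    induction n with
    | zero => simp [Finset.sum_range_succ, primeInv_zero, primeInv_one]
    | succ n ih =>
      rw [Finset.sum_range_succ, ih, Finset.sum_range_succ _ (n + 1 + 1)]
      simp only [hz]; push_cast
      rw [show (n : ℝ) + 1 + 1 = n + 2 by ring]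
      ring
  have hb : ∀ n, ‖∑ i ∈ Finset.range n, z i‖ ≤ C := fun n => by
    rw [hsum]; exact hC (n + 1) (by omega)
  obtain ⟨L', hL'⟩ := cauchySeq_tendsto_of_complete
    (hanti.cauchySeq_series_mul_of_tendsto_zero_of_bounded hzero hb)
  refine ⟨L' + L, (tendsto_add_atTop_iff_nat 1).1 ((hL'.add hL).congr fun n => ?_)⟩
  rw [add_sub, ← Finset.sum_add_distrib]
  push_cast
  congr 1
  rw [Finset.sum_range_succ' _ (n + 1), Finset.sum_range_succ' _ n, primeInv_zero, primeInv_one,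
    add_zero, add_zero]
  refine Finset.sum_congr rfl fun i _ => ?_
  have := (hlogpos i).ne'
  simp only [hz, smul_eq_mul]
  field_simp
  ring

/-! ### The prime zeta function near its singularity. -/

/-- The prime zeta function `∑_p p^{-1-δ}`. -/
noncomputable def primeZeta (δ : ℝ) : ℝ := ∑' n : ℕ, primeInv n * (n : ℝ) ^ (-δ)

/-- The sum of `1 / p` over the primes `p` in the dyadic interval `(2^{k-1}, 2^k]`. -/
noncomputable def dyadicPrimeSum (k : ℕ) : ℝ :=
  ∑ n ∈ Finset.range (2 ^ k + 1), primeInv n - ∑ n ∈ Finset.range (2 ^ (k - 1) + 1), primeInv n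

lemma primeInv_mul_rpow_le (n : ℕ) (δ : ℝ) :
    primeInv n * (n : ℝ) ^ (-δ) ≤ 1 / (n : ℝ) ^ (1 + δ) := by
  rcases Nat.eq_zero_or_pos n with rfl | hn
  · rw [primeInv_zero, zero_mul]; positivity
  · have hn' : (0 : ℝ) < n := by exact_mod_cast hn
    calc primeInv n * (n : ℝ) ^ (-δ) ≤ 1 / n * (n : ℝ) ^ (-δ) := by
          gcongr; exact primeInv_le n
      _ = 1 / (n : ℝ) ^ (1 + δ) := by
          rw [Real.rpow_add hn', Real.rpow_one, Real.rpow_neg hn'.le]; field_simp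

lemma summable_primeInv_mul_rpow {δ : ℝ} (hδ : 0 < δ) :
    Summable fun n : ℕ => primeInv n * (n : ℝ) ^ (-δ) :=
  (Real.summable_one_div_nat_rpow.2 (by linarith : 1 < 1 + δ)).of_nonneg_of_le
    (fun n => mul_nonneg (primeInv_nonneg n) (by positivity)) fun n => primeInv_mul_rpow_le n δ

/-- Truncated subtraction gives `0 - 1 = 0`, so the two sums cancel. -/
lemma dyadicPrimeSum_zero : dyadicPrimeSum 0 = 0 := by simp [dyadicPrimeSum]

lemma dyadicPrimeSum_succ (k : ℕ) :
    dyadicPrimeSum (k + 1) = ∑ n ∈ Finset.Ico (2 ^ k + 1) (2 ^ (k + 1) + 1), primeInv n := by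
  rw [dyadicPrimeSum, Nat.add_sub_cancel, Finset.sum_Ico_eq_sub]
  have := Nat.pow_le_pow_right (n := 2) (by norm_num) (Nat.le_succ k)
  simpa using this

lemma dyadicPrimeSum_nonneg (k : ℕ) : 0 ≤ dyadicPrimeSum k := by
  cases k with
  | zero => exact dyadicPrimeSum_zero.ge
  | succ k => rw [dyadicPrimeSum_succ]; exact Finset.sum_nonneg fun n _ => primeInv_nonneg n

lemma sum_dyadicPrimeSum (K : ℕ) :
    ∑ k ∈ Finset.range (K + 1), dyadicPrimeSum k = ∑ n ∈ Finset.range (2 ^ K + 1), primeInv n := by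
  induction K with
  | zero => simp [dyadicPrimeSum_zero, Finset.sum_range_succ, primeInv_zero, primeInv_one]
  | succ K ih => rw [Finset.sum_range_succ, ih, dyadicPrimeSum, Nat.add_sub_cancel]; ring

/-- On `(2^{k-1}, 2^k]` one has `2^{-δ} n^{-δ} ≤ 2^{-δk} ≤ n^{-δ}`. This traps the prime zeta
function by a power series in `x = 2^{-δ}`, to which Abel's theorem applies. -/
lemma sum_dyadicPrimeSum_mul_pow_le {δ : ℝ} (hδ : 0 < δ) (K : ℕ) :
    ∑ k ∈ Finset.range (K + 1), dyadicPrimeSum k * ((2 : ℝ) ^ (-δ)) ^ k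
      ≤ ∑ n ∈ Finset.range (2 ^ K + 1), primeInv n * (n : ℝ) ^ (-δ) ∧
    2 ^ (-δ) * ∑ n ∈ Finset.range (2 ^ K + 1), primeInv n * (n : ℝ) ^ (-δ)
      ≤ ∑ k ∈ Finset.range (K + 1), dyadicPrimeSum k * ((2 : ℝ) ^ (-δ)) ^ k := by
  induction K with
  | zero => simp [dyadicPrimeSum_zero, Finset.sum_range_succ, primeInv_zero, primeInv_one]
  | succ K ih =>
    have hle : 2 ^ K + 1 ≤ 2 ^ (K + 1) + 1 := by
      simpa using Nat.pow_le_pow_right (n := 2) (by norm_num) (Nat.le_succ K)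
    have hx : (0 : ℝ) < 2 ^ (-δ) := by positivity
    have hpow : ∀ k : ℕ, ((2 ^ k : ℝ)) ^ (-δ) = ((2 : ℝ) ^ (-δ)) ^ k := fun k => by
      rw [← Real.rpow_natCast, ← Real.rpow_mul (by norm_num), mul_comm, Real.rpow_mul (by norm_num),
        Real.rpow_natCast]
    rw [Finset.sum_range_succ, dyadicPrimeSum_succ,
      ← Finset.sum_range_add_sum_Ico (fun n : ℕ => primeInv n * (n : ℝ) ^ (-δ)) hle, mul_add,
      Finset.sum_mul]
    refine ⟨add_le_add ih.1 (Finset.sum_le_sum fun n hn => ?_), add_le_add ih.2 ?_⟩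
    · rw [Finset.mem_Ico] at hn
      refine mul_le_mul_of_nonneg_left ?_ (primeInv_nonneg n)
      rw [← hpow]
      refine Real.rpow_le_rpow_of_nonpos ?_ ?_ (by linarith)
      · exact_mod_cast (by omega : 0 < n)
      · exact_mod_cast (by omega : n ≤ 2 ^ (K + 1))
    · rw [Finset.mul_sum]
      refine Finset.sum_le_sum fun n hn => ?_
      rw [Finset.mem_Ico] at hn
      rw [mul_left_comm, pow_succ, mul_comm (((2 : ℝ) ^ (-δ)) ^ K)]
      refine mul_le_mul_of_nonneg_left (mul_le_mul_of_nonneg_left ?_ hx.le) (primeInv_nonneg n)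
      rw [← hpow]
      refine Real.rpow_le_rpow_of_nonpos (by positivity) ?_ (by linarith)
      exact_mod_cast (by omega : 2 ^ K ≤ n)

lemma summable_dyadicPrimeSum_mul_pow {δ : ℝ} (hδ : 0 < δ) :
    Summable fun k : ℕ => dyadicPrimeSum k * ((2 : ℝ) ^ (-δ)) ^ k := by
  refine summable_of_sum_range_le (c := primeZeta δ)
    (fun k => mul_nonneg (dyadicPrimeSum_nonneg k) (by positivity)) fun K => ?_
  refine le_trans ?_ ((sum_dyadicPrimeSum_mul_pow_le hδ K).1.trans
    ((summable_primeInv_mul_rpow hδ).sum_le_tsum _ fun n _ =>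
      mul_nonneg (primeInv_nonneg n) (by positivity)))
  rw [Finset.sum_range_succ]
  exact le_add_of_nonneg_right (mul_nonneg (dyadicPrimeSum_nonneg K) (by positivity))

lemma tsum_dyadicPrimeSum_mul_pow_le {δ : ℝ} (hδ : 0 < δ) :
    ∑' k : ℕ, dyadicPrimeSum k * ((2 : ℝ) ^ (-δ)) ^ k ≤ primeZeta δ ∧
    2 ^ (-δ) * primeZeta δ ≤ ∑' k : ℕ, dyadicPrimeSum k * ((2 : ℝ) ^ (-δ)) ^ k := by
  have h1 : Tendsto (fun K : ℕ => ∑ k ∈ Finset.range (K + 1),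
      dyadicPrimeSum k * ((2 : ℝ) ^ (-δ)) ^ k) atTop _ :=
    (tendsto_add_atTop_iff_nat 1).2 (summable_dyadicPrimeSum_mul_pow hδ).hasSum.tendsto_sum_nat
  have h2 : Tendsto (fun K : ℕ => ∑ n ∈ Finset.range (2 ^ K + 1),
      primeInv n * (n : ℝ) ^ (-δ)) atTop (𝓝 (primeZeta δ)) :=
    (summable_primeInv_mul_rpow hδ).hasSum.tendsto_sum_nat.comp
      ((tendsto_add_atTop_nat 1).comp (tendsto_pow_atTop_atTop_of_one_lt (by norm_num)))
  exact ⟨le_of_tendsto_of_tendsto' h1 h2 fun K => (sum_dyadicPrimeSum_mul_pow_le hδ K).1,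
    le_of_tendsto_of_tendsto' (h2.const_mul _) h1 fun K => (sum_dyadicPrimeSum_mul_pow_le hδ K).2⟩

lemma tendsto_two_rpow_neg_nhdsGT_zero :
    Tendsto (fun δ : ℝ => (2 : ℝ) ^ (-δ)) (𝓝[>] 0) (𝓝[<] 1) := by
  refine tendsto_nhdsWithin_iff.2 ⟨?_, ?_⟩
  · have : Continuous fun δ : ℝ => (2 : ℝ) ^ (-δ) :=
      continuous_const.rpow continuous_neg fun _ => Or.inl (by norm_num)
    have h := (this.tendsto 0).mono_left (nhdsWithin_le_nhds (s := Set.Ioi 0))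
    simpa using h
  · filter_upwards [self_mem_nhdsWithin] with δ hδ
    exact Real.rpow_lt_one_of_one_lt_of_neg (by norm_num) (neg_lt_zero.2 hδ)

lemma tendsto_log_sub_log_one_sub_two_rpow_neg :
    Tendsto (fun δ : ℝ => Real.log δ - Real.log (1 - (2 : ℝ) ^ (-δ))) (𝓝[>] 0)
      (𝓝 (-Real.log (Real.log 2))) := by
  have hl : 0 < Real.log 2 := Real.log_pos (by norm_num)
  have hd : HasDerivAt (fun δ : ℝ => 1 - (2 : ℝ) ^ (-δ)) (Real.log 2) 0 := by
    have := ((hasDerivAt_neg (0 : ℝ)).const_rpow (a := 2) (by norm_num)).const_sub 1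
    simpa using this
  have h := (hd.tendsto_slope.mono_left (nhdsWithin_mono 0 (fun x (hx : 0 < x) => hx.ne') :
    𝓝[>] (0 : ℝ) ≤ 𝓝[≠] 0)).log hl.ne'
  refine h.neg.congr' ?_
  filter_upwards [self_mem_nhdsWithin] with δ hδ
  have hδ' : 0 < δ := hδ
  have : 0 < 1 - (2 : ℝ) ^ (-δ) :=
    sub_pos.2 (Real.rpow_lt_one_of_one_lt_of_neg (by norm_num) (neg_lt_zero.2 hδ'))
  simp only [slope_def_field, neg_zero, Real.rpow_zero, sub_self, sub_zero]
  rw [Real.log_div this.ne' hδ'.ne']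
  ring

/-- The dyadic sums up to `K` total `log (K log 2) + M + o(1)`, so subtracting `1/k` termwise leaves
a series converging to `M + log log 2 - γ`. Abel's theorem transfers this to `x → 1-`, where `∑ x^k
/ k = -log (1 - x)`. -/
lemma tendsto_primeZeta_add_log {M : ℝ}
    (hM : Tendsto (fun N : ℕ => ∑ n ∈ Finset.range (N + 1), primeInv n - Real.log (Real.log N))
      atTop (𝓝 M)) :
    Tendsto (fun δ => primeZeta δ + Real.log δ) (𝓝[>] 0)
      (𝓝 (M - Real.eulerMascheroniConstant)) := by
  have hl : 0 < Real.log 2 := Real.log_pos (by norm_num)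
  set ℓ := M + Real.log (Real.log 2) - Real.eulerMascheroniConstant with hℓ
  set S : ℝ → ℝ := fun x => ∑' k : ℕ, dyadicPrimeSum k * x ^ k with hS
  -- The term `k = 0` vanishes, as `1 / 0 = 0`.
  have hpart : Tendsto (fun K : ℕ => ∑ k ∈ Finset.range K, (dyadicPrimeSum k - 1 / (k : ℝ))) atTop
      (𝓝 ℓ) := by
    rw [← tendsto_add_atTop_iff_nat 1]
    have h1 := hM.comp (tendsto_pow_atTop_atTop_of_one_lt (r := 2) (by norm_num))
    refine ((h1.add_const (Real.log (Real.log 2))).sub Real.tendsto_harmonic_sub_log).congr' ?_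
    filter_upwards [eventually_gt_atTop 0] with K hK
    have hK' : (0 : ℝ) < K := by exact_mod_cast hK
    have hh : ∑ k ∈ Finset.range (K + 1), 1 / (k : ℝ) = (harmonic K : ℝ) := by
      rw [Finset.sum_range_succ', harmonic]
      simp
    rw [Finset.sum_sub_distrib, sum_dyadicPrimeSum, hh]
    simp only [Function.comp_apply]
    push_cast
    rw [Real.log_pow, Real.log_mul hK'.ne' hl.ne']
    ring
  have habel := (Real.tendsto_tsum_powerSeries_nhdsWithin_lt hpart).comp
    tendsto_two_rpow_neg_nhdsGT_zero
  have hS1 : Tendsto (fun δ : ℝ => S (2 ^ (-δ)) + Real.log (1 - 2 ^ (-δ))) (𝓝[>] 0) (𝓝 ℓ) := by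
    refine habel.congr' ?_
    filter_upwards [self_mem_nhdsWithin] with δ hδ
    have hδ' : 0 < δ := hδ
    have hx0 : (0 : ℝ) < 2 ^ (-δ) := by positivity
    have hx1 : (2 : ℝ) ^ (-δ) < 1 :=
      Real.rpow_lt_one_of_one_lt_of_neg (by norm_num) (neg_lt_zero.2 hδ')
    have hlog := Real.hasSum_pow_div_log_of_abs_lt_one (abs_lt.2 ⟨by linarith, hx1⟩)
    have hlog' : HasSum (fun k : ℕ => 1 / (k : ℝ) * ((2 : ℝ) ^ (-δ)) ^ k)
        (-Real.log (1 - 2 ^ (-δ))) := by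
      rw [← hasSum_nat_add_iff' 1]
      simp only [Finset.range_one, Finset.sum_singleton, Nat.cast_zero, div_zero, zero_mul, sub_zero]
      refine hlog.congr_fun fun k => ?_
      push_cast; ring
    simp only [Function.comp_apply, sub_mul]
    rw [(summable_dyadicPrimeSum_mul_pow hδ').tsum_sub hlog'.summable, hlog'.tsum_eq]
    ring
  have hx := tendsto_nhds_of_tendsto_nhdsWithin tendsto_two_rpow_neg_nhdsGT_zero
  have hx' : Tendsto (fun δ : ℝ => 1 - (2 : ℝ) ^ (-δ)) (𝓝[>] 0) (𝓝 0) := by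
    simpa using hx.const_sub 1
  -- Since `S` grows only like `-log (1 - x)`, the gap `S / x - S = S (1 - x) / x` between the two
  -- bounds tends to zero.
  have hS2 : Tendsto (fun δ : ℝ => S (2 ^ (-δ)) * (1 - 2 ^ (-δ))) (𝓝[>] 0) (𝓝 0) := by
    have h1 := hS1.mul hx'
    have h2 : Tendsto (fun δ : ℝ => (1 - (2 : ℝ) ^ (-δ)) * Real.log (1 - 2 ^ (-δ))) (𝓝[>] 0)
        (𝓝 0) := by
      have := (Real.continuous_mul_log.tendsto 0).comp hx'
      rwa [zero_mul] at this
    have := h1.sub h2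
    rw [mul_zero, sub_zero] at this
    exact this.congr fun δ => by ring
  have hS3 : Tendsto (fun δ : ℝ => S (2 ^ (-δ)) / 2 ^ (-δ) + Real.log (1 - 2 ^ (-δ))) (𝓝[>] 0)
      (𝓝 ℓ) := by
    have := hS1.add (hS2.div hx one_ne_zero)
    rw [zero_div, add_zero] at this
    refine this.congr fun δ => ?_
    have : (2 : ℝ) ^ (-δ) ≠ 0 := by positivity
    simp only [Pi.div_apply]
    field_simp
    ring
  have hP : Tendsto (fun δ : ℝ => primeZeta δ + Real.log (1 - 2 ^ (-δ))) (𝓝[>] 0) (𝓝 ℓ) := by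
    refine tendsto_of_tendsto_of_tendsto_of_le_of_le' hS1 hS3 ?_ ?_
    · filter_upwards [self_mem_nhdsWithin] with δ hδ
      have := (tsum_dyadicPrimeSum_mul_pow_le hδ).1
      simp only [hS]; linarith
    · filter_upwards [self_mem_nhdsWithin] with δ hδ
      have := (tsum_dyadicPrimeSum_mul_pow_le hδ).2
      have h2 : primeZeta δ ≤ S (2 ^ (-δ)) / 2 ^ (-δ) := by
        rw [le_div_iff₀ (by positivity), mul_comm]; exact this
      linarith
  have := hP.add tendsto_log_sub_log_one_sub_two_rpow_neg
  rw [show ℓ + -Real.log (Real.log 2) = M - Real.eulerMascheroniConstant by rw [hℓ]; ring] at this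
  exact this.congr fun δ => by ring

/-! ### Euler products, the constant in Mertens' second theorem, and Mertens' third theorem. -/

/-- The function that sends a prime `p` to `-log (1 - p^{-s}) - p^{-s}` and every other natural
number to `0`. -/
noncomputable def primeLogRemainder (s : ℝ) (n : ℕ) : ℝ :=
  if n.Prime then -Real.log (1 - (n : ℝ) ^ (-s)) - (n : ℝ) ^ (-s) else 0

lemma rpow_neg_le_inv {s : ℝ} (hs : 1 ≤ s) {p : ℕ} (hp : p.Prime) :
    (p : ℝ) ^ (-s) ≤ 1 / p := by
  rw [one_div, ← Real.rpow_neg_one]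
  exact Real.rpow_le_rpow_of_exponent_le (by exact_mod_cast hp.one_lt.le) (by linarith)

lemma rpow_neg_le_half {s : ℝ} (hs : 1 ≤ s) {p : ℕ} (hp : p.Prime) :
    (p : ℝ) ^ (-s) ≤ 1 / 2 :=
  (rpow_neg_le_inv hs hp).trans
    (one_div_le_one_div_of_le (by norm_num) (by exact_mod_cast hp.two_le))

/-- For `0 ≤ t ≤ 1/2`, `0 ≤ -log (1 - t) - t ≤ 2 t²`. The bound is uniform in `s ≥ 1`, as dominated
convergence at `s = 1` requires. -/
lemma abs_primeLogRemainder_le {s : ℝ} (hs : 1 ≤ s) (n : ℕ) :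
    ‖primeLogRemainder s n‖ ≤ 2 * (1 / (n : ℝ) ^ 2) := by
  unfold primeLogRemainder
  split_ifs with hp
  · have h1 := rpow_neg_le_inv hs hp
    have h2 := rpow_neg_le_half hs hp
    have h0 : 0 ≤ (n : ℝ) ^ (-s) := by positivity
    set t := (n : ℝ) ^ (-s)
    have hl := Real.log_le_sub_one_of_pos (show 0 < 1 - t by linarith)
    have hu := Real.one_sub_inv_le_log_of_pos (show 0 < 1 - t by linarith)
    have hv : (1 - t)⁻¹ ≤ 1 + t + 2 * t ^ 2 := by
      rw [inv_le_iff_one_le_mul₀ (by linarith)]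
      nlinarith [mul_nonneg (sq_nonneg t) (by linarith : 0 ≤ 1 - 2 * t)]
    have ht2 : t ^ 2 ≤ 1 / (n : ℝ) ^ 2 := by
      rw [← one_div_pow]; exact pow_le_pow_left₀ h0 h1 2
    rw [Real.norm_eq_abs, abs_of_nonneg (by linarith)]
    linarith
  · rw [norm_zero]; positivity

lemma summable_two_mul_one_div_sq : Summable fun n : ℕ => 2 * (1 / (n : ℝ) ^ 2) :=
  (Real.summable_one_div_nat_pow.2 (by norm_num)).mul_left 2

lemma summable_primeLogRemainder {s : ℝ} (hs : 1 ≤ s) : Summable (primeLogRemainder s) :=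
  Summable.of_norm_bounded summable_two_mul_one_div_sq (abs_primeLogRemainder_le hs)

lemma tendsto_prod_primesBelow_riemannZeta_re {s : ℝ} (hs : 1 < s) :
    Tendsto (fun N : ℕ => ∏ p ∈ N.primesBelow, (1 - (p : ℝ) ^ (-s))⁻¹) atTop
      (𝓝 (riemannZeta s).re) := by
  have h := (Complex.continuous_re.tendsto _).comp
    (riemannZeta_eulerProduct (s := (s : ℂ)) (by simpa using hs))
  refine h.congr fun N => ?_
  have : ∏ p ∈ N.primesBelow, (1 - (p : ℂ) ^ (-(s : ℂ)))⁻¹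
      = ((∏ p ∈ N.primesBelow, (1 - (p : ℝ) ^ (-s))⁻¹ : ℝ) : ℂ) := by
    push_cast
    refine Finset.prod_congr rfl fun p _ => ?_
    rw [Complex.ofReal_cpow (by positivity)]
    push_cast; rfl
  simp only [Function.comp_apply]
  rw [this, Complex.ofReal_re]

lemma log_prod_primesBelow {s : ℝ} (hs : 1 ≤ s) (N : ℕ) :
    Real.log (∏ p ∈ N.primesBelow, (1 - (p : ℝ) ^ (-s))⁻¹)
      = ∑ n ∈ Finset.range N, primeInv n * (n : ℝ) ^ (-(s - 1))
        + ∑ n ∈ Finset.range N, primeLogRemainder s n := by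
  rw [← Finset.sum_add_distrib, Real.log_prod, Nat.primesBelow_eq_filter_range, Finset.sum_filter]
  · refine Finset.sum_congr rfl fun n _ => ?_
    unfold primeInv primeLogRemainder
    split_ifs with hp
    · have hn : (0 : ℝ) < n := by exact_mod_cast hp.pos
      rw [Real.log_inv, neg_sub, Real.rpow_sub hn, Real.rpow_one, Real.rpow_neg hn.le]
      field_simp; ring
    · ring
  · intro p hp
    have := rpow_neg_le_half hs (Nat.prime_of_mem_primesBelow hp)
    exact (inv_pos.2 (by linarith)).ne'

lemma log_riemannZeta_re {δ : ℝ} (hδ : 0 < δ) :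
    Real.log (riemannZeta ((1 + δ : ℝ) : ℂ)).re
      = primeZeta δ + ∑' n, primeLogRemainder (1 + δ) n := by
  have h := tendsto_prod_primesBelow_riemannZeta_re (s := 1 + δ) (by linarith)
  -- Every Euler factor is at least `1`; the limit is therefore nonzero and `log` is continuous
  -- there.
  have h1 : 1 ≤ (riemannZeta ((1 + δ : ℝ) : ℂ)).re := by
    refine ge_of_tendsto' h fun N => ?_
    refine le_of_eq_of_le Finset.prod_const_one.symm
      (Finset.prod_le_prod (fun _ _ => zero_le_one) fun p hp => ?_)
    have h2 := rpow_neg_le_half (s := 1 + δ) (by linarith) (Nat.prime_of_mem_primesBelow hp)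
    have h3 : 0 ≤ (p : ℝ) ^ (-(1 + δ)) := by positivity
    exact (one_le_inv₀ (by linarith)).2 (by linarith)
  refine tendsto_nhds_unique (h.log (by linarith)) ?_
  have h2 := (summable_primeInv_mul_rpow hδ).hasSum.tendsto_sum_nat.add
    (summable_primeLogRemainder (s := 1 + δ) (by linarith)).hasSum.tendsto_sum_nat
  refine h2.congr fun N => ?_
  rw [log_prod_primesBelow (by linarith), add_sub_cancel_left]

lemma tendsto_tsum_primeLogRemainder :
    Tendsto (fun δ : ℝ => ∑' n, primeLogRemainder (1 + δ) n) (𝓝[>] 0)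
      (𝓝 (∑' n, primeLogRemainder 1 n)) := by
  refine tendsto_tsum_of_dominated_convergence summable_two_mul_one_div_sq (fun n => ?_) ?_
  · refine tendsto_nhdsWithin_of_tendsto_nhds ?_
    unfold primeLogRemainder
    split_ifs with hp
    · have hn : (n : ℝ) ≠ 0 := by exact_mod_cast hp.ne_zero
      have hc : Tendsto (fun δ : ℝ => (n : ℝ) ^ (-(1 + δ))) (𝓝 0) (𝓝 ((n : ℝ) ^ (-1 : ℝ))) := by
        have : Continuous fun δ : ℝ => (n : ℝ) ^ (-(1 + δ)) :=
          continuous_const.rpow (by fun_prop) fun _ => Or.inl hn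
        simpa using this.tendsto 0
      have h2 := rpow_neg_le_half le_rfl hp
      exact ((hc.const_sub 1).log (by linarith)).neg.sub hc
    · exact tendsto_const_nhds
  · filter_upwards [self_mem_nhdsWithin] with δ hδ n
    exact abs_primeLogRemainder_le (by linarith [show 0 < δ from hδ]) n

/-- The pole of `ζ` gives `log ζ(1 + δ) + log δ → 0`. Comparison with the Abel limit `M - γ` plus
the limit of the remainder sums determines `M`. -/
lemma tendsto_sum_primeInv_sub_log_log :
    Tendsto (fun N : ℕ => ∑ n ∈ Finset.range (N + 1), primeInv n - Real.log (Real.log N)) atTop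
      (𝓝 (Real.eulerMascheroniConstant - ∑' n, primeLogRemainder 1 n)) := by
  obtain ⟨M, hM⟩ := exists_tendsto_sum_primeInv_sub_log_log
  have h1 := (tendsto_primeZeta_add_log hM).add tendsto_tsum_primeLogRemainder
  have h2 : Tendsto (fun δ : ℝ => (1 : ℝ) + δ) (𝓝[>] 0) (𝓝[>] 1) := by
    refine tendsto_nhdsWithin_iff.2 ⟨?_, ?_⟩
    · have : Continuous fun δ : ℝ => (1 : ℝ) + δ := by fun_prop
      simpa using (this.tendsto 0).mono_left (nhdsWithin_le_nhds (s := Set.Ioi 0))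
    · filter_upwards [self_mem_nhdsWithin] with δ hδ
      simpa using hδ
  have h3 := (log_riemannZeta_add_log_sub_isLittleO_ofReal.tendsto_div_nhds_zero).comp h2
  have h4 : M - Real.eulerMascheroniConstant + ∑' n, primeLogRemainder 1 n = 0 := by
    refine tendsto_nhds_unique (h1.congr' ?_) h3
    filter_upwards [self_mem_nhdsWithin] with δ hδ
    simp only [Function.comp_apply, div_one, add_sub_cancel_left]
    rw [log_riemannZeta_re hδ]
    ring
  rwa [show Real.eulerMascheroniConstant - ∑' n, primeLogRemainder 1 n = M by linarith]

/-- Mertens' third theorem. -/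
theorem tendsto_prod_primesBelow_div_log :
    Tendsto (fun N : ℕ => (∏ p ∈ (N + 1).primesBelow, (1 - 1 / (p : ℝ))⁻¹) / Real.log N) atTop
      (𝓝 (Real.exp Real.eulerMascheroniConstant)) := by
  have h := tendsto_sum_primeInv_sub_log_log.add ((tendsto_add_atTop_iff_nat 1).2
    (summable_primeLogRemainder le_rfl).hasSum.tendsto_sum_nat)
  rw [sub_add_cancel] at h
  refine ((Real.continuous_exp.tendsto _).comp h).congr' ?_
  filter_upwards [eventually_gt_atTop 1] with N hN
  have hl : 0 < Real.log N := Real.log_pos (by exact_mod_cast hN)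
  have hlog : Real.log (∏ p ∈ (N + 1).primesBelow, (1 - 1 / (p : ℝ))⁻¹)
      = ∑ n ∈ Finset.range (N + 1), primeInv n
        + ∑ n ∈ Finset.range (N + 1), primeLogRemainder 1 n := by
    simpa [Real.rpow_neg_one] using log_prod_primesBelow (s := 1) le_rfl (N + 1)
  have hpos : 0 < ∏ p ∈ (N + 1).primesBelow, (1 - 1 / (p : ℝ))⁻¹ := by
    refine Finset.prod_pos fun p hp => ?_
    have : (1 : ℝ) < p := by exact_mod_cast Nat.one_lt_of_mem_primesBelow hp
    have := (div_lt_one (by linarith)).2 this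
    exact inv_pos.2 (by linarith)
  simp only [Function.comp_apply]
  rw [sub_add_eq_add_sub, ← hlog, Real.exp_sub, Real.exp_log hl, Real.exp_log hpos]

/-- Use `1 + 1/p = (1 - p^{-2}) (1 - 1/p)^{-1}` and the Euler product of `ζ(2)`. -/
lemma tendsto_prod_one_add_inv_div_log :
    Tendsto (fun N : ℕ => (∏ p ∈ (N + 1).primesBelow, (1 + 1 / (p : ℝ))) / Real.log N) atTop
      (𝓝 (6 / Real.pi ^ 2 * Real.exp Real.eulerMascheroniConstant)) := by
  have h2 := tendsto_prod_primesBelow_riemannZeta_re (s := 2) (by norm_num)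
  have hz : (riemannZeta ((2 : ℝ) : ℂ)).re = Real.pi ^ 2 / 6 := by
    rw [Complex.ofReal_ofNat, riemannZeta_two]
    norm_cast
  rw [hz] at h2
  have h3 := ((tendsto_add_atTop_iff_nat 1).2 (h2.inv₀ (by positivity))).mul
    tendsto_prod_primesBelow_div_log
  rw [inv_div] at h3
  refine h3.congr fun N => ?_
  rw [← mul_div_assoc, ← Finset.prod_inv_distrib, ← Finset.prod_mul_distrib]
  congr 1
  refine Finset.prod_congr rfl fun p hp => ?_
  have hp1 : (1 : ℝ) < p := by exact_mod_cast Nat.one_lt_of_mem_primesBelow hp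
  have : (p : ℝ) - 1 ≠ 0 := by linarith
  rw [inv_inv, Real.rpow_neg (by positivity), Real.rpow_two]
  field_simp
  ring

/-! ### Extremal order: the upper bound and the primorials. -/

lemma tendsto_primorial_atTop : Tendsto primorial atTop atTop := by
  refine tendsto_atTop_atTop.2 fun B => ?_
  obtain ⟨p, hpB, hp⟩ := Nat.exists_infinite_primes B
  refine ⟨p, fun j hj => hpB.trans (Nat.le_of_dvd (primorial_pos j) ?_)⟩
  exact Nat.dvd_of_mem_primeFactors
    (by rw [primeFactors_primorial]; exact Nat.mem_primesLE.2 ⟨hj, hp⟩)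

/-- The prime factors of `n` below `log n` contribute to `∏_{p ∣ n} (1 + 1/p)` at most the product
over all primes up to `log n`, the others at most `exp (1 / log log n)`. -/
lemma prod_primeFactors_one_add_inv_le {n : ℕ} (hn : 1 < Real.log n) :
    ∏ p ∈ n.primeFactors, (1 + 1 / (p : ℝ))
      ≤ (∏ p ∈ (⌊Real.log n⌋₊ + 1).primesBelow, (1 + 1 / (p : ℝ)))
        * Real.exp (1 / Real.log (Real.log n)) := by
  set y := Real.log n with hy
  have hn0 : n ≠ 0 := by rintro rfl; norm_num [hy] at hn
  have hly : 0 < Real.log y := Real.log_pos hn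
  have hone : ∀ p : ℕ, (1 : ℝ) ≤ 1 + 1 / (p : ℝ) := fun p => by
    have : (0 : ℝ) ≤ 1 / p := by positivity
    linarith
  rw [← Finset.prod_filter_mul_prod_filter_not n.primeFactors (fun p => p ≤ ⌊y⌋₊)]
  refine mul_le_mul ?_ ?_ (by positivity) (by positivity)
  · have hsub : n.primeFactors.filter (fun p => p ≤ ⌊y⌋₊) ⊆ (⌊y⌋₊ + 1).primesBelow := by
      intro p hp
      rw [Finset.mem_filter] at hp
      exact Nat.mem_primesBelow.2 ⟨by omega, Nat.prime_of_mem_primeFactors hp.1⟩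
    rw [← Finset.prod_sdiff hsub]
    refine le_mul_of_one_le_left (by positivity) ?_
    exact le_of_eq_of_le Finset.prod_const_one.symm
      (Finset.prod_le_prod (fun _ _ => zero_le_one) fun p _ => hone p)
  · set S := n.primeFactors.filter (fun p => ¬ p ≤ ⌊y⌋₊) with hS
    have hyS : ∀ p ∈ S, y ≤ p := fun p hp => by
      have := (Finset.mem_filter.1 hp).2
      exact ((Nat.floor_lt (by linarith)).1 (not_le.1 this)).le
    -- The large prime factors have product dividing `n = e^y`, and each is at least `y`, so there
    -- are at most `y / log y` of them.
    have hpow : y ^ S.card ≤ n := by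
      have hd : ∏ p ∈ S, p ≤ n := Nat.le_of_dvd (Nat.pos_of_ne_zero hn0)
        ((Finset.prod_dvd_prod_of_subset _ _ _ (Finset.filter_subset _ _)).trans
          (Nat.prod_primeFactors_dvd n))
      calc y ^ S.card = ∏ p ∈ S, y := by rw [Finset.prod_const]
        _ ≤ ∏ p ∈ S, (p : ℝ) := Finset.prod_le_prod (fun _ _ => by linarith) hyS
        _ ≤ n := by rw [← Nat.cast_prod]; exact Nat.cast_le.2 hd
    have hcard : S.card * Real.log y ≤ y := by
      rw [← Real.log_pow]
      exact Real.log_le_log (by positivity) hpow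
    calc ∏ p ∈ S, (1 + 1 / (p : ℝ)) ≤ ∏ p ∈ S, Real.exp (1 / y) := by
          refine Finset.prod_le_prod (fun _ _ => by positivity) fun p hp => ?_
          have h1 := Real.add_one_le_exp (1 / y)
          have h2 : 1 / (p : ℝ) ≤ 1 / y := one_div_le_one_div_of_le (by linarith) (hyS p hp)
          linarith
      _ = Real.exp (S.card * (1 / y)) := by rw [Finset.prod_const, ← Real.exp_nat_mul]
      _ ≤ Real.exp (1 / Real.log y) := by
          refine Real.exp_le_exp.2 ?_
          rw [mul_one_div, div_le_div_iff₀ (by linarith) hly]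
          linarith

lemma tendsto_prod_primesBelow_floor_log_mul_exp :
    Tendsto (fun n : ℕ => (∏ p ∈ (⌊Real.log n⌋₊ + 1).primesBelow, (1 + 1 / (p : ℝ)))
        / Real.log ⌊Real.log n⌋₊ * Real.exp (1 / Real.log (Real.log n))) atTop
      (𝓝 (6 / Real.pi ^ 2 * Real.exp Real.eulerMascheroniConstant)) := by
  have hlog : Tendsto (fun n : ℕ => Real.log n) atTop atTop :=
    Real.tendsto_log_atTop.comp tendsto_natCast_atTop_atTop
  have h1 := tendsto_prod_one_add_inv_div_log.comp (tendsto_nat_floor_atTop.comp hlog)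
  have h2 : Tendsto (fun n : ℕ => Real.exp (1 / Real.log (Real.log n))) atTop (𝓝 1) := by
    have h0 : Tendsto (fun n : ℕ => 1 / Real.log (Real.log n)) atTop (𝓝 0) := by
      simp only [one_div]
      exact (Real.tendsto_log_atTop.comp hlog).inv_tendsto_atTop
    have := (Real.continuous_exp.tendsto 0).comp h0
    rwa [Real.exp_zero] at this
  simpa using h1.mul h2

lemma regCount_mul_sigma_div_le {n : ℕ} (hn : 2 ≤ Real.log n) :
    (regCount n : ℝ) * (ArithmeticFunction.sigma 1 n : ℝ)
        / ((n : ℝ) ^ 2 * Real.log (Real.log n))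
      ≤ (∏ p ∈ (⌊Real.log n⌋₊ + 1).primesBelow, (1 + 1 / (p : ℝ)))
        / Real.log ⌊Real.log n⌋₊ * Real.exp (1 / Real.log (Real.log n)) := by
  have hn0 : n ≠ 0 := by rintro rfl; norm_num at hn
  have hn' : (0 : ℝ) < n := by exact_mod_cast Nat.pos_of_ne_zero hn0
  have hfl : 2 ≤ ⌊Real.log n⌋₊ := Nat.le_floor (by exact_mod_cast hn)
  have hlf : 0 < Real.log ⌊Real.log n⌋₊ := Real.log_pos (by exact_mod_cast hfl)
  -- Replacing `log log n` by the smaller `log ⌊log n⌋` matches the cutoff in Mertens' product and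
  -- only enlarges the quotient.
  have hle : Real.log ⌊Real.log n⌋₊ ≤ Real.log (Real.log n) :=
    Real.log_le_log (by exact_mod_cast (by omega : 0 < ⌊Real.log n⌋₊))
      (Nat.floor_le (by linarith))
  rw [← div_div, div_mul_eq_mul_div]
  refine div_le_div₀ (by positivity) ?_ hlf hle
  refine le_trans ?_ (prod_primeFactors_one_add_inv_le (by linarith))
  rw [div_le_iff₀ (by positivity), mul_comm (∏ p ∈ n.primeFactors, _)]
  exact regCount_mul_sigma_le n hn0

/-- Chebyshev's bound `θ(j) ≤ j log 4` suffices in place of the prime number theorem: after a second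
logarithm its constant is only additive. -/
lemma le_regCount_mul_dedekindPsi_primorial_div {j : ℕ} (hj : 3 ≤ j) :
    (∏ p ∈ (j + 1).primesBelow, (1 + 1 / (p : ℝ))) / (Real.log (Real.log 4) + Real.log j)
      ≤ (regCount (primorial j) : ℝ) * dedekindPsi (primorial j)
        / ((primorial j : ℝ) ^ 2 * Real.log (Real.log (primorial j))) := by
  have hN : (0 : ℝ) < primorial j := by exact_mod_cast primorial_pos j
  have hpf : (primorial j).primeFactors = (j + 1).primesBelow := by
    rw [primeFactors_primorial, Nat.primesBelow_eq_primesLE_sub_one, Nat.add_sub_cancel]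
  rw [regCount_of_squarefree (squarefree_primorial j), dedekindPsi, hpf]
  -- The divisors `2` and `3` push the primorial above `e`, making `log log` positive.
  have hN6 : (6 : ℝ) ≤ primorial j := by
    have h : (3 : ℕ) * 2 ∣ primorial j := by
      refine Nat.Coprime.mul_dvd_of_dvd_of_dvd (by norm_num) ?_ ?_ <;>
      · refine Nat.dvd_of_mem_primeFactors ?_
        rw [hpf]
        exact Nat.mem_primesBelow.2 ⟨by omega, by norm_num⟩
    exact_mod_cast Nat.le_of_dvd (primorial_pos j) h
  have hj' : (0 : ℝ) < j := by exact_mod_cast (by omega : 0 < j)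
  have h4 : 0 < Real.log 4 := Real.log_pos (by norm_num)
  have h1 : 1 < Real.log (primorial j) := by
    rw [Real.lt_log_iff_exp_lt hN]
    linarith [Real.exp_one_lt_three]
  have hth : Real.log (primorial j) ≤ Real.log 4 * j := by
    have := Chebyshev.theta_le_log4_mul_x hj'.le
    rwa [Chebyshev.theta_eq_log_primorial, Nat.floor_natCast] at this
  have hll : Real.log (Real.log (primorial j)) ≤ Real.log (Real.log 4) + Real.log j := by
    rw [← Real.log_mul h4.ne' hj'.ne']
    exact Real.log_le_log (by linarith) hth
  have hpos : 0 < Real.log (Real.log (primorial j)) := Real.log_pos h1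
  rw [← mul_assoc, ← pow_two, mul_div_mul_left _ _ (by positivity)]
  exact div_le_div_of_nonneg_left (by positivity) hpos hll

lemma tendsto_prod_primesBelow_div_const_add_log (a : ℝ) :
    Tendsto (fun j : ℕ => (∏ p ∈ (j + 1).primesBelow, (1 + 1 / (p : ℝ))) / (a + Real.log j)) atTop
      (𝓝 (6 / Real.pi ^ 2 * Real.exp Real.eulerMascheroniConstant)) := by
  have hlog : Tendsto (fun n : ℕ => Real.log n) atTop atTop :=
    Real.tendsto_log_atTop.comp tendsto_natCast_atTop_atTop
  have h1 : Tendsto (fun j : ℕ => a / Real.log j + 1) atTop (𝓝 1) := by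
    simpa using (tendsto_const_nhds.div_atTop hlog).add_const 1
  have h2 := tendsto_prod_one_add_inv_div_log.div h1 one_ne_zero
  rw [div_one] at h2
  refine h2.congr' ?_
  filter_upwards [hlog.eventually_gt_atTop 0] with j hj
  simp only [Pi.div_apply]
  rw [div_div]
  congr 1
  field_simp


theorem mainTheorem4 :
    Filter.limsup
        (fun n : ℕ =>
          (((regCount n : ℝ) * (ArithmeticFunction.sigma 1 n : ℝ) /
            ((n : ℝ) ^ 2 * Real.log (Real.log (n : ℝ))) : ℝ) : EReal))
        Filter.atTop
      = ((6 / Real.pi ^ 2 * Real.exp Real.eulerMascheroniConstant : ℝ) : EReal) ∧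
    Filter.limsup
        (fun n : ℕ =>
          (((regCount n : ℝ) * dedekindPsi n /
            ((n : ℝ) ^ 2 * Real.log (Real.log (n : ℝ))) : ℝ) : EReal))
        Filter.atTop
      = ((6 / Real.pi ^ 2 * Real.exp Real.eulerMascheroniConstant : ℝ) : EReal) := by
  set c : ℝ := 6 / Real.pi ^ 2 * Real.exp Real.eulerMascheroniConstant
  set F : ℕ → EReal := fun n => (((regCount n : ℝ) * (ArithmeticFunction.sigma 1 n : ℝ) /
    ((n : ℝ) ^ 2 * Real.log (Real.log (n : ℝ))) : ℝ) : EReal)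
  set G : ℕ → EReal := fun n => (((regCount n : ℝ) * dedekindPsi n /
    ((n : ℝ) ^ 2 * Real.log (Real.log (n : ℝ))) : ℝ) : EReal)
  have hlog : Tendsto (fun n : ℕ => Real.log n) atTop atTop :=
    Real.tendsto_log_atTop.comp tendsto_natCast_atTop_atTop
  have hGF : limsup G atTop ≤ limsup F atTop := by
    refine limsup_le_limsup ?_
    filter_upwards [hlog.eventually_ge_atTop 1] with n hn
    have : 0 ≤ Real.log (Real.log n) := Real.log_nonneg hn
    refine EReal.coe_le_coe_iff.2 ?_
    gcongr
    exact dedekindPsi_le_sigma n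
  have hF : limsup F atTop ≤ c := by
    have h := (continuous_coe_real_ereal.tendsto _).comp tendsto_prod_primesBelow_floor_log_mul_exp
    refine le_trans (limsup_le_limsup ?_) h.limsup_eq.le
    filter_upwards [hlog.eventually_ge_atTop 2] with n hn
    exact EReal.coe_le_coe_iff.2 (regCount_mul_sigma_div_le hn)
  have hG : (c : EReal) ≤ limsup G atTop := by
    have h := (continuous_coe_real_ereal.tendsto _).comp
      (tendsto_prod_primesBelow_div_const_add_log (Real.log (Real.log 4)))
    refine h.limsup_eq.ge.trans (le_trans (limsup_le_limsup (v := G ∘ primorial) ?_) ?_)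
    · filter_upwards [eventually_ge_atTop 3] with j hj
      exact EReal.coe_le_coe_iff.2 (le_regCount_mul_dedekindPsi_primorial_div hj)
    · exact limsup_le_limsup_of_le tendsto_primorial_atTop
  exact ⟨le_antisymm hF (hG.trans hGF), le_antisymm (hGF.trans hF) hG⟩
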